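/- Let $k\ge 2$ be an integer and let $G$ be a finite simple graph with $n$ vertices. A set $S\subseteq V_G$ is a generalized $k$-independent set if the induced subgraph $G[S]$ contains no tree on $k$ vertices as a (not necessarily induced) subgraph, and $\alpha_k(G)$ is the maximum size of such a set. Let $\omega(G)=|E_G|-|V_G|+c(G)$ be the dimension of the cycle space of $G$, where $c(G)$ is the number of connected components of $G$. Let $\Gamma_G$ be the graph obtained from $G$ by deleting all vertices that lie on cycles, together with all incident edges. For $i\ge 1$, define families $R_i^k$ of trees on $ik$ vertices recursively: $R_1^k$ is the set of all trees on $k$ vertices, and for $i\ge2$ a tree $T$ lies in $R_i^k$ if it is obtained from the disjoint union of some $T'\in R_{i-1}^k$ and some tree $T''$ on $k$ vertices by adding a single edge joining a vertex of $T'$ to a vertex of $T''$. Then $$\alpha_k(G)\ \ge\ \frac{k-1}{k}\bigl(n-\omega(G)\bigr).$$ Equality holds if and only if all of the following conditions hold: (i) the cycles (if any) of $G$ are pairwise vertex-disjoint, i.e. any two distinct cycles of $G$ have no common vertex; (ii) each cycle (if any) of $G$ has length congruent to $1$ modulo $k$; (iii) each connected component $T$ of $\Gamma_G$ satisfies $k\mid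 |V_T|$ and $T\in R^k_{|V_T|/k}$. -/

import Mathlib

namespace GenIndep

universe u

/-- `S` is a generalized `k`-independent set of `G`: the induced subgraph `G[S]` contains no
(not necessarily induced) subgraph that is a tree on `k` vertices. -/
def IsGenIndepSet {V : Type u} (G : SimpleGraph V) (k : ℕ) (S : Set V) : Prop :=
  ¬ ∃ H : (G.induce S).Subgraph, H.coe.IsTree ∧ H.verts.ncard = k

/-- The generalized `k`-independence number `α_k(G)`: the maximum size of a generalized
`k`-independent set (the graphs considered are finite and `k ≥ 2`, so that the maximum exists). -/
noncomputable def genIndepNum {V : Type u} (G : SimpleGraph V) (k : ℕ) : ℕ :=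
  sSup {m : ℕ | ∃ S : Set V, IsGenIndepSet G k S ∧ S.ncard = m}

/-- The dimension of the cycle space, `ω(G) = |E| - |V| + c(G)`, for a finite graph. -/
noncomputable def cycleDim {V : Type u} (G : SimpleGraph V) : ℤ :=
  (G.edgeSet.ncard : ℤ) - (Nat.card V : ℤ) + (Nat.card G.ConnectedComponent : ℤ)

/-- The vertices of `G` that lie on no cycle. -/
def nonCycleVerts {V : Type u} (G : SimpleGraph V) : Set V :=
  {v | ∀ (u : V) (c : G.Walk u u), c.IsCycle → v ∉ c.support}

/-- `Γ_G`: the graph obtained from `G` by deleting all vertices that lie on cycles. -/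
def Gam {V : Type u} (G : SimpleGraph V) : SimpleGraph (nonCycleVerts G) :=
  G.induce (nonCycleVerts G)

/-- The cycles of `G` are pairwise vertex-disjoint: two cycles that are different as subgraphs
of `G` have no common vertex. -/
def CyclesDisjoint {V : Type u} (G : SimpleGraph V) : Prop :=
  ∀ (u v : V) (c : G.Walk u u) (d : G.Walk v v), c.IsCycle → d.IsCycle →
    c.toSubgraph ≠ d.toSubgraph → Disjoint c.toSubgraph.verts d.toSubgraph.verts

/-- `InR k i T` says that `T` belongs to the family `R_i^k` (`i ≥ 1`): `R_1^k` consists of the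
trees on `k` vertices, and `T ∈ R_{i+1}^k` if `T` is (up to isomorphism) obtained from the
disjoint union of some `T₁ ∈ R_i^k` and a tree `T₂` on `k` vertices by adding one edge joining
a vertex of `T₁` to a vertex of `T₂`. -/
def InR (k : ℕ) : ℕ → ∀ {V : Type u}, SimpleGraph V → Prop
  | 0, _, _ => False
  | 1, V, T => T.IsTree ∧ Nat.card V = k
  | i + 2, _, T =>
      ∃ (V₁ V₂ : Type u) (T₁ : SimpleGraph V₁) (T₂ : SimpleGraph V₂) (a : V₁) (b : V₂),
        InR k (i + 1) T₁ ∧ T₂.IsTree ∧ Nat.card V₂ = k ∧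
          Nonempty (T ≃g (T₁.sum T₂ ⊔ SimpleGraph.edge (Sum.inl a) (Sum.inr b)))

end GenIndep

/-! Lower bound. A spanning forest `F` with the same components as `G` leaves out exactly `ω(G)`
edges. Choosing an endpoint of each gives a set `X` with at most `ω(G)` vertices such that `G - X`
is a forest, so it suffices to find a generalized `k`-independent subset of a forest that omits at
most one vertex in `k` (`exists_isGenIndepSet_of_isAcyclic`). A minimal pendant branch with at least
`k` vertices becomes independent once its root is deleted; cut it off and repeat. If nothing is
gained, every branch has exactly `k` vertices, and gluing the branches back shows that each
component lies in some `R_i^k`.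

Necessity. If two different cycles share a vertex, two edges at one vertex can be left out of the
forest and covered together, so the bound is strict. Once the cycles are disjoint, any set `X` with
one vertex from each cycle is an admissible cover, and equality puts every component of `G - X` into
the families `R_i^k`. A component of `Γ_G` is attached to each cycle at one vertex at most
(`CyclesDisjoint.eq_of_adj`), so `X` can be chosen to separate it from all cycles. Keeping a cycle
minus one vertex as well gives the congruence for its length by divisibility.

Sufficiency. An independent set omits at least `i` vertices of a tree in `R_i^k` and at least `q +
1` vertices of a cycle of length `kq + 1`. Summing over the disjoint pieces gives the upper bound,
since `ω(G)` is at most the number of cycles. -/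

namespace GenIndep

universe u

open SimpleGraph

variable {V : Type u} {G : SimpleGraph V}

/-! ### Connected vertex sets -/

/-- A subset of a connected vertex set `A` that is closed under adjacency in `A` and meets `A`
contains `A`. -/
lemma subset_of_connected_of_closed {A B : Set V} (hA : (G.induce A).Connected) {a : V}
    (haA : a ∈ A) (haB : a ∈ B) (hcl : ∀ x ∈ A, x ∈ B → ∀ y ∈ A, G.Adj x y → y ∈ B) :
    A ⊆ B := by
  intro y hy
  obtain ⟨p⟩ := hA.preconnected ⟨a, haA⟩ ⟨y, hy⟩
  have key : ∀ (x z : A) (_ : (G.induce A).Walk x z), (x : V) ∈ B → (z : V) ∈ B := by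
    intro x z p
    induction p with
    | nil => exact id
    | @cons x w z h p ih => exact fun hx => ih (hcl x x.2 hx w w.2 (by simpa using h))
  exact key _ _ p haB

/-- The vertex set `K` is a connected component of the subgraph of `G` induced by `S`. -/
structure IsComponentIn (G : SimpleGraph V) (S K : Set V) : Prop where
  subset : K ⊆ S
  connected : (G.induce K).Connected
  closed : ∀ x ∈ K, ∀ y ∈ S, G.Adj x y → y ∈ K

/-- The graph of a connected component of an induced subgraph is an induced subgraph. -/
noncomputable def componentIso (S : Set V) (C : (G.induce S).ConnectedComponent) :
    C.toSimpleGraph ≃g G.induce (Subtype.val '' C.supp) where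
  toEquiv := Equiv.Set.image _ C.supp Subtype.val_injective
  map_rel_iff' := by
    intro a b
    rfl

lemma isComponentIn_image_supp (S : Set V) (C : (G.induce S).ConnectedComponent) :
    IsComponentIn G S (Subtype.val '' C.supp) where
  subset := by
    rintro _ ⟨x, -, rfl⟩
    exact x.2
  connected := (componentIso S C).connected_iff.1 C.connected_toSimpleGraph
  closed := by
    rintro _ ⟨x, hx, rfl⟩ y hy hxy
    exact ⟨⟨y, hy⟩, C.mem_supp_of_adj_mem_supp hx (by simpa using hxy), rfl⟩

lemma exists_isComponentIn {S : Set V} {a : V} (ha : a ∈ S) :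
    ∃ K, IsComponentIn G S K ∧ a ∈ K :=
  ⟨_, isComponentIn_image_supp S ((G.induce S).connectedComponentMk ⟨a, ha⟩),
    ⟨⟨a, ha⟩, rfl, rfl⟩⟩

lemma IsComponentIn.subset_of_connected {S K A : Set V} (hK : IsComponentIn G S K)
    (hA : (G.induce A).Connected) (hAS : A ⊆ S) {a : V} (haA : a ∈ A) (haK : a ∈ K) : A ⊆ K :=
  subset_of_connected_of_closed hA haA haK fun x _ hx y hy hxy => hK.closed x hx y (hAS hy) hxy

lemma reachable_deleteEdges_of_connected {A : Set V} (hA : (G.induce A).Connected) {x y z : V}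
    (hx : x ∈ A) (hy : y ∈ A) (hz : z ∉ A) (t : V) :
    (G.deleteEdges {s(z, t)}).Reachable x y := by
  let f : G.induce A →g G.deleteEdges {s(z, t)} :=
    { toFun := Subtype.val
      map_rel' := by
        intro a b hab
        rw [deleteEdges_adj]
        refine ⟨by simpa using hab, ?_⟩
        intro h
        have : z ∈ s((a : V), (b : V)) := by
          rw [Set.mem_singleton_iff.1 h]; simp
        rcases Sym2.mem_iff.1 this with h | h
        · exact hz (h ▸ a.2)
        · exact hz (h ▸ b.2) }
  exact (hA.preconnected ⟨x, hx⟩ ⟨y, hy⟩).map f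

/-- In a forest, a vertex outside a connected set has at most one neighbour in that set. -/
lemma _root_.SimpleGraph.IsAcyclic.eq_of_adj_connected (hG : G.IsAcyclic) {A : Set V}
    (hA : (G.induce A).Connected) {x y v : V} (hx : x ∈ A) (hy : y ∈ A) (hv : v ∉ A)
    (hxv : G.Adj x v) (hyv : G.Adj y v) : x = y := by
  by_contra hne
  have hb := isAcyclic_iff_forall_adj_isBridge.1 hG hxv.symm
  rw [isBridge_iff] at hb
  refine hb (Reachable.symm ((reachable_deleteEdges_of_connected hA hx hy hv x).trans
    (Adj.reachable ?_)))
  rw [deleteEdges_adj]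
  refine ⟨hyv, ?_⟩
  intro h
  have : s(y, v) = s(v, x) := h
  rw [Sym2.eq_iff] at this
  rcases this with ⟨h, -⟩ | ⟨h, -⟩
  · exact hv (h ▸ hy)
  · exact hne h.symm

lemma connected_image_Icc {f : ℕ → V} {a b : ℕ} (hab : a ≤ b)
    (h : ∀ i, a ≤ i → i < b → G.Adj (f i) (f (i + 1))) :
    (G.induce (f '' Set.Icc a b)).Connected := by
  induction b, hab using Nat.le_induction with
  | base =>
    rw [show f '' Set.Icc a a = {f a} by simp]
    exact (SimpleGraph.connected_iff _).2 ⟨Preconnected.of_subsingleton, inferInstance⟩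
  | succ b hab ih =>
    have h1 : f '' Set.Icc a (b + 1) = f '' Set.Icc a b ∪ {f b, f (b + 1)} := by
      ext x
      simp only [Set.mem_image, Set.mem_Icc, Set.mem_union, Set.mem_insert_iff,
        Set.mem_singleton_iff]
      constructor
      · rintro ⟨i, hi, rfl⟩
        rcases Nat.lt_or_ge b i with h | h
        · exact Or.inr (Or.inr (by rw [show i = b + 1 by omega]))
        · exact Or.inl ⟨i, ⟨hi.1, h⟩, rfl⟩
      · rintro (⟨i, hi, rfl⟩ | rfl | rfl)
        · exact ⟨i, ⟨hi.1, by omega⟩, rfl⟩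
        · exact ⟨b, ⟨hab, by omega⟩, rfl⟩
        · exact ⟨b + 1, ⟨by omega, le_rfl⟩, rfl⟩
    rw [h1]
    exact induce_union_connected (ih fun i h1 h2 => h i h1 (by omega)).preconnected
      (induce_pair_connected_of_adj (h b hab (by omega))).preconnected
      ⟨f b, ⟨b, ⟨hab, le_rfl⟩, rfl⟩, by simp⟩

/-! ### Generalized independent sets -/

/-- A connected set has a spanning tree, and the vertex set of a tree induces a connected graph.
Trees can thus be replaced by connected sets of `k` vertices. -/
lemma isGenIndepSet_iff [Finite V] {k : ℕ} {S : Set V} :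
    IsGenIndepSet G k S ↔ ∀ A ⊆ S, A.ncard = k → ¬ (G.induce A).Connected := by
  constructor
  · rintro hS A hAS hA hc
    apply hS
    obtain ⟨T, hT, hTree⟩ := hc.exists_isTree_le
    let e : A ↪ S := ⟨Set.inclusion hAS, Set.inclusion_injective hAS⟩
    let H : (G.induce S).Subgraph :=
      { verts := Set.range (Set.inclusion hAS)
        Adj := (T.map e).Adj
        adj_sub := by
          intro x y h
          obtain ⟨a, b, hab, rfl, rfl⟩ := (SimpleGraph.map_adj _ _ _ _).1 h
          exact hT hab
        edge_vert := by
          intro x y h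
          obtain ⟨a, b, hab, rfl, rfl⟩ := (SimpleGraph.map_adj _ _ _ _).1 h
          exact ⟨a, rfl⟩
        symm := ⟨fun x y h => (T.map e).adj_symm h⟩ }
    let φ : T ≃g H.coe :=
      { toEquiv := Equiv.ofInjective _ (Set.inclusion_injective hAS)
        map_rel_iff' := by
          intro a b
          exact SimpleGraph.map_adj_apply (f := e) }
    refine ⟨H, φ.isTree_iff.1 hTree, ?_⟩
    change (Set.range (Set.inclusion hAS)).ncard = k
    rw [← hA, ← Nat.card_coe_set_eq, ← Nat.card_coe_set_eq]
    exact (Nat.card_congr φ.toEquiv).symm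
  · rintro hS ⟨H, hT, hk⟩
    refine hS (Subtype.val '' H.verts) ?_ ?_ ?_
    · rintro _ ⟨x, -, rfl⟩
      exact x.2
    · rw [Set.ncard_image_of_injective _ Subtype.val_injective, hk]
    · let φ : (G.induce S).induce H.verts ≃g G.induce (Subtype.val '' H.verts) :=
        { toEquiv := Equiv.Set.image _ H.verts Subtype.val_injective
          map_rel_iff' := by
            intro a b
            rfl }
      refine φ.connected_iff.1 ?_
      exact (Subgraph.connected_iff'.2 hT.connected).induce_verts

lemma IsGenIndepSet.preimage {W : Type u} {H : SimpleGraph W} [Finite V] [Finite W] {k : ℕ}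
    {S : Set V} (hS : IsGenIndepSet G k S) (f : H →g G) (hf : Function.Injective f) :
    IsGenIndepSet H k (f ⁻¹' S) := by
  rw [isGenIndepSet_iff] at *
  intro A hA hk hc
  refine hS (f '' A) (by rintro _ ⟨x, hx, rfl⟩; exact hA hx)
    (by rw [Set.ncard_image_of_injective _ hf, hk]) ?_
  let g : H.induce A →g G.induce (f '' A) :=
    { toFun := fun x => ⟨f x, x, x.2, rfl⟩
      map_rel' := by
        intro a b hab
        exact f.map_adj hab }
  refine hc.map g ?_
  rintro ⟨_, x, hx, rfl⟩
  exact ⟨⟨x, hx⟩, rfl⟩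

lemma IsGenIndepSet.union [Finite V] {k : ℕ} {S T : Set V}
    (hS : IsGenIndepSet G k S) (hT : IsGenIndepSet G k T)
    (h : ∀ x ∈ S, ∀ y ∈ T, ¬ G.Adj x y) : IsGenIndepSet G k (S ∪ T) := by
  rw [isGenIndepSet_iff] at *
  intro A hA hk hc
  obtain ⟨⟨a, ha⟩⟩ := hc.nonempty
  rcases hA ha with h1 | h1
  · refine hS A (subset_of_connected_of_closed hc ha h1 fun x _ hx y hy hxy => ?_) hk hc
    exact (hA hy).resolve_right fun hy' => h x hx y hy' hxy
  · refine hT A (subset_of_connected_of_closed hc ha h1 fun x _ hx y hy hxy => ?_) hk hc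
    exact (hA hy).resolve_left fun hy' => h y hy' x hx hxy.symm

lemma bddAbove_ncard_isGenIndepSet [Finite V] (k : ℕ) :
    BddAbove {m : ℕ | ∃ S : Set V, IsGenIndepSet G k S ∧ S.ncard = m} :=
  ⟨Nat.card V, by rintro _ ⟨S, -, rfl⟩; exact Set.ncard_le_card S⟩

lemma IsGenIndepSet.ncard_le [Finite V] {k : ℕ} {S : Set V} (hS : IsGenIndepSet G k S) :
    S.ncard ≤ genIndepNum G k :=
  le_csSup (bddAbove_ncard_isGenIndepSet k) ⟨S, hS, rfl⟩

lemma exists_isGenIndepSet_ncard [Finite V] {k : ℕ} (hk : k ≠ 0) :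
    ∃ S : Set V, IsGenIndepSet G k S ∧ S.ncard = genIndepNum G k := by
  suffices h : IsGenIndepSet G k ∅ from
    Nat.sSup_mem (s := {m : ℕ | ∃ S : Set V, IsGenIndepSet G k S ∧ S.ncard = m})
      ⟨0, ∅, h, by simp⟩ (bddAbove_ncard_isGenIndepSet (G := G) k)
  rw [isGenIndepSet_iff]
  intro A hA hA'
  rw [Set.subset_empty_iff.1 hA, Set.ncard_empty] at hA'
  exact absurd hA'.symm hk

/-! ### Counting the edges of a forest -/

lemma card_eq_sum_card_connectedComponent (G : SimpleGraph V) [Finite V]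
    [Fintype G.ConnectedComponent] :
    Nat.card V = ∑ C : G.ConnectedComponent, Nat.card C := by
  rw [← Nat.card_sigma]
  refine Nat.card_congr
    { toFun := fun v => ⟨G.connectedComponentMk v, ⟨v, rfl⟩⟩
      invFun := fun x => x.2.1
      left_inv := fun _ => rfl
      right_inv := ?_ }
  rintro ⟨C, v, rfl⟩
  rfl

/-- Each component is a tree, with one edge fewer than vertices; sum over the components. -/
lemma _root_.SimpleGraph.IsAcyclic.ncard_edgeSet_add_card_connectedComponent [Finite V]
    (hG : G.IsAcyclic) :
    G.edgeSet.ncard + Nat.card G.ConnectedComponent = Nat.card V := by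
  classical
  have := Fintype.ofFinite V
  have hE : G.edgeSet.ncard = ∑ C : G.ConnectedComponent, Nat.card C.toSimpleGraph.edgeSet := by
    rw [← Nat.card_sigma, ← Nat.card_coe_set_eq]
    symm
    refine Nat.card_congr (Equiv.ofBijective
      (fun x => ⟨Sym2.map Subtype.val x.2.1, ?_⟩) ⟨?_, ?_⟩)
    · obtain ⟨C, ⟨e, he⟩⟩ := x
      induction e with | h a b => exact he
    · rintro ⟨C, ⟨e, he⟩⟩ ⟨C', ⟨e', he'⟩⟩ h
      have h : Sym2.map Subtype.val e = Sym2.map Subtype.val e' := congrArg Subtype.val h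
      have hC : C = C' := by
        induction e with | h a b =>
        induction e' with | h a' b' =>
        have : (a : V) ∈ s((a' : V), (b' : V)) := by
          rw [← Sym2.map_mk, ← h]; simp
        rcases Sym2.mem_iff.1 this with h | h
        · rw [← a.2, ← a'.2, h]
        · rw [← a.2, ← b'.2, h]
      subst hC
      have := Sym2.map.injective Subtype.val_injective h
      subst this
      rfl
    · rintro ⟨e, he⟩
      induction e with | h a b =>
      refine ⟨⟨G.connectedComponentMk a, ⟨s(⟨a, rfl⟩, ⟨b, ?_⟩), ?_⟩⟩, rfl⟩
      · exact ConnectedComponent.sound he.symm.reachable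
      · exact he
  have hT : ∀ C : G.ConnectedComponent, Nat.card C.toSimpleGraph.edgeSet + 1 = Nat.card C :=
    fun C => (isTree_iff_connected_and_card.1 (hG.isTree_connectedComponent C)).2
  rw [card_eq_sum_card_connectedComponent G, hE, ← Finset.sum_congr rfl fun C _ => hT C,
    Finset.sum_add_distrib]
  simp [Nat.card_eq_fintype_card]

/-! ### The families of trees -/

lemma InR.of_iso {k i : ℕ} {W : Type u} {H : SimpleGraph W} (h : InR k i G) (e : H ≃g G) :
    InR k i H := by
  match i, h with
  | 0, h => exact h
  | 1, h => exact ⟨e.isTree_iff.2 h.1, (Nat.card_congr e.toEquiv).trans h.2⟩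
  | i + 2, ⟨V₁, V₂, T₁, T₂, a, b, h₁, h₂, h₃, ⟨φ⟩⟩ =>
    exact ⟨V₁, V₂, T₁, T₂, a, b, h₁, h₂, h₃, ⟨e.trans φ⟩⟩

lemma not_inR_zero {k : ℕ} : ¬ InR k 0 G := fun h => h

lemma InR.card_eq {k i : ℕ} [Finite V] (h : InR k i G) : Nat.card V = k * i := by
  induction i using Nat.strong_induction_on generalizing V with
  | _ i ih =>
    match i, h with
    | 1, h => rw [h.2, mul_one]
    | i + 2, ⟨V₁, V₂, T₁, T₂, a, b, h₁, h₂, h₃, ⟨φ⟩⟩ =>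
      have : Finite (V₁ ⊕ V₂) := Finite.of_equiv _ φ.toEquiv
      have : Finite V₁ := Finite.of_injective (Sum.inl : V₁ → V₁ ⊕ V₂) Sum.inl_injective
      have : Finite V₂ := Finite.of_injective (Sum.inr : V₂ → V₁ ⊕ V₂) Sum.inr_injective
      rw [Nat.card_congr φ.toEquiv, Nat.card_sum, h₃, ih (i + 1) (by omega) h₁]
      ring

lemma one_le_ncard_compl_of_connected [Finite V] {k : ℕ} (hG : G.Connected)
    (hV : Nat.card V = k) {S : Set V} (hS : IsGenIndepSet G k S) : 1 ≤ Sᶜ.ncard := by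
  by_contra hlt
  have h0 : Sᶜ = ∅ := (Set.ncard_eq_zero).1 (by omega)
  have hS' : S = Set.univ := Set.compl_empty_iff.1 h0
  subst hS'
  exact isGenIndepSet_iff.1 hS Set.univ subset_rfl (by rw [Set.ncard_univ, hV])
    ((induceUnivIso G).connected_iff.2 hG)

/-- The construction of the tree splits its vertices into `i` connected blocks of size `k`, and each
block must lose a vertex. -/
lemma InR.le_ncard_compl {k i : ℕ} [Finite V] (h : InR k i G) {S : Set V}
    (hS : IsGenIndepSet G k S) : i ≤ Sᶜ.ncard := by
  induction i using Nat.strong_induction_on generalizing V with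
  | _ i ih =>
    match i, h with
    | 1, h => exact one_le_ncard_compl_of_connected h.1.connected h.2 hS
    | i + 2, ⟨V₁, V₂, T₁, T₂, a, b, h₁, h₂, h₃, ⟨φ⟩⟩ =>
      have : Finite (V₁ ⊕ V₂) := Finite.of_equiv _ φ.toEquiv
      have : Finite V₁ := Finite.of_injective (Sum.inl : V₁ → V₁ ⊕ V₂) Sum.inl_injective
      have : Finite V₂ := Finite.of_injective (Sum.inr : V₂ → V₁ ⊕ V₂) Sum.inr_injective
      let f₁ : T₁ →g G :=
        { toFun := fun x => φ.symm (Sum.inl x)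
          map_rel' := fun {x y} hxy =>
            φ.symm.map_adj_iff.2 (Or.inl (by simpa using hxy)) }
      let f₂ : T₂ →g G :=
        { toFun := fun x => φ.symm (Sum.inr x)
          map_rel' := fun {x y} hxy =>
            φ.symm.map_adj_iff.2 (Or.inl (by simpa using hxy)) }
      have hf₁ : Function.Injective f₁ := φ.symm.injective.comp Sum.inl_injective
      have hf₂ : Function.Injective f₂ := φ.symm.injective.comp Sum.inr_injective
      have e₁ := ih (i + 1) (by omega) h₁ (hS.preimage f₁ hf₁)
      have e₂ := one_le_ncard_compl_of_connected h₂.connected h₃ (hS.preimage f₂ hf₂)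
      rw [← Set.ncard_image_of_injective _ hf₁] at e₁
      rw [← Set.ncard_image_of_injective _ hf₂] at e₂
      have hd : Disjoint (f₁ '' (f₁ ⁻¹' S)ᶜ) (f₂ '' (f₂ ⁻¹' S)ᶜ) := by
        rw [Set.disjoint_left]
        rintro _ ⟨x, -, rfl⟩ ⟨y, -, hxy⟩
        exact absurd (φ.symm.injective hxy) (by simp)
      have hsub : f₁ '' (f₁ ⁻¹' S)ᶜ ∪ f₂ '' (f₂ ⁻¹' S)ᶜ ⊆ Sᶜ := by
        rintro _ (⟨x, hx, rfl⟩ | ⟨x, hx, rfl⟩) <;> exact hx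
      have := Set.ncard_le_ncard hsub
      rw [Set.ncard_union_eq hd] at this
      omega

lemma inR_one_of_connected (hG : G.IsAcyclic) {k : ℕ} {D : Set V}
    (hD : (G.induce D).Connected) (hk : D.ncard = k) : InR k 1 (G.induce D) :=
  ⟨⟨hD, hG.induce D⟩, by rw [Nat.card_coe_set_eq, hk]⟩

/-- Attaching a tree on `k` vertices by an edge. -/
lemma InR.induce_of_diff (hG : G.IsAcyclic) {k i : ℕ} {K D : Set V} (hDK : D ⊆ K)
    (hR : InR k i (G.induce (K \ D))) (hD : (G.induce D).Connected) (hk : D.ncard = k)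
    {v w : V} (hv : v ∈ D) (hw : w ∈ K \ D) (hvw : G.Adj v w)
    (huniq : ∀ x ∈ D, ∀ y ∈ K \ D, G.Adj x y → x = v ∧ y = w) :
    InR k (i + 1) (G.induce K) := by
  obtain _ | i := i
  · exact absurd hR not_inR_zero
  let f : ↥(K \ D) ⊕ ↥D → K :=
    Sum.elim (Set.inclusion Set.sdiff_subset) (Set.inclusion hDK)
  have hf : Function.Bijective f := by
    constructor
    · rintro (⟨x, hx⟩ | ⟨x, hx⟩) (⟨y, hy⟩ | ⟨y, hy⟩) h <;>
        have h : x = y := congrArg Subtype.val h <;> subst h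
      · rfl
      · exact absurd hy hx.2
      · exact absurd hx hy.2
      · rfl
    · rintro ⟨x, hx⟩
      by_cases hxD : x ∈ D
      · exact ⟨Sum.inr ⟨x, hxD⟩, rfl⟩
      · exact ⟨Sum.inl ⟨x, hx, hxD⟩, rfl⟩
  let φ : ((G.induce (K \ D)).sum (G.induce D) ⊔
      SimpleGraph.edge (Sum.inl ⟨w, hw⟩) (Sum.inr ⟨v, hv⟩)) ≃g G.induce K :=
    { toEquiv := Equiv.ofBijective f hf
      map_rel_iff' := by
        rintro (⟨x, hx⟩ | ⟨x, hx⟩) (⟨y, hy⟩ | ⟨y, hy⟩)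
        · simp [f, edge_adj]
        · simp only [f, Equiv.ofBijective_apply, Sum.elim_inl, Sum.elim_inr, comap_adj,
            Set.inclusion_mk, Function.Embedding.subtype_apply, sup_adj, edge_adj]
          constructor
          · intro h
            obtain ⟨rfl, rfl⟩ := huniq y hy x hx h.symm
            exact Or.inr ⟨Or.inl ⟨rfl, rfl⟩, by simp⟩
          · rintro (h | ⟨⟨h1, h2⟩ | ⟨h1, h2⟩, -⟩)
            · simp at h
            · obtain rfl : x = w := by simpa using h1
              obtain rfl : y = v := by simpa using h2
              exact hvw.symm
            · simp at h1
        · simp only [f, Equiv.ofBijective_apply, Sum.elim_inl, Sum.elim_inr, comap_adj,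
            Set.inclusion_mk, Function.Embedding.subtype_apply, sup_adj, edge_adj]
          constructor
          · intro h
            obtain ⟨rfl, rfl⟩ := huniq x hx y hy h
            exact Or.inr ⟨Or.inr ⟨rfl, rfl⟩, by simp⟩
          · rintro (h | ⟨⟨h1, h2⟩ | ⟨h1, h2⟩, -⟩)
            · simp at h
            · simp at h1
            · obtain rfl : x = v := by simpa using h1
              obtain rfl : y = w := by simpa using h2
              exact hvw
        · simp [f, edge_adj] }
  exact ⟨_, _, _, _, _, _, hR, ⟨hD, hG.induce D⟩, by rw [Nat.card_coe_set_eq, hk], ⟨φ.symm⟩⟩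

/-! ### Forests -/

/-- A vertex set of a forest that contains a tree on `k` vertices has a pendant branch `D` with
root `v` and at least `k` vertices, such that `D` becomes independent on removing the root. -/
lemma exists_branch [Finite V] (hG : G.IsAcyclic) {k : ℕ} {S : Set V}
    (hS : ¬ IsGenIndepSet G k S) :
    ∃ D ⊆ S, (G.induce D).Connected ∧ k ≤ D.ncard ∧ ∃ v ∈ D, ∃ w,
      (∀ x ∈ D, ∀ y ∈ S \ D, G.Adj x y → x = v ∧ y = w) ∧ IsGenIndepSet G k (D \ {v}) := by
  -- Descent on the size of a branch `D` attached to the rest of `S` by at most the edge `vw`: if `D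
  -- \ {v}` still contains a tree on `k` vertices, the component containing it is a smaller branch,
  -- attached only through `v`.
  suffices key : ∀ n, ∀ D ⊆ S, D.ncard = n → (G.induce D).Connected → k ≤ D.ncard →
      ∀ v ∈ D, ∀ w, (∀ x ∈ D, ∀ y ∈ S \ D, G.Adj x y → x = v ∧ y = w) →
      ∃ D ⊆ S, (G.induce D).Connected ∧ k ≤ D.ncard ∧ ∃ v ∈ D, ∃ w,
        (∀ x ∈ D, ∀ y ∈ S \ D, G.Adj x y → x = v ∧ y = w) ∧ IsGenIndepSet G k (D \ {v}) by
    rw [isGenIndepSet_iff] at hS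
    push Not at hS
    obtain ⟨A, hAS, hA, hc⟩ := hS
    obtain ⟨⟨a, ha⟩⟩ := hc.nonempty
    obtain ⟨K, hK, haK⟩ := exists_isComponentIn (G := G) (hAS ha)
    -- A whole component has no outgoing edges in `S`, so root and outer neighbour are arbitrary.
    refine key _ K hK.subset rfl hK.connected ?_ a haK a ?_
    · rw [← hA]
      exact Set.ncard_le_ncard (hK.subset_of_connected hc hAS ha haK)
    · intro x hx y hy hxy
      exact absurd (hK.closed x hx y hy.1 hxy) hy.2
  intro n
  induction n using Nat.strong_induction_on with
  | _ n ih =>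
    intro D hDS hn hD hkD v hv w huniq
    by_cases hI : IsGenIndepSet G k (D \ {v})
    · exact ⟨D, hDS, hD, hkD, v, hv, w, huniq, hI⟩
    rw [isGenIndepSet_iff] at hI
    push Not at hI
    obtain ⟨A, hAD, hA, hc⟩ := hI
    obtain ⟨⟨a, ha⟩⟩ := hc.nonempty
    obtain ⟨K, hK, haK⟩ := exists_isComponentIn (G := G) (hAD ha)
    have hvK : v ∉ K := fun h => (hK.subset h).2 rfl
    have hKD : K ⊆ D := hK.subset.trans Set.sdiff_subset
    have hout : ∀ x ∈ K, ∀ y ∈ S \ K, G.Adj x y → y = v := by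
      intro x hx y hy hxy
      by_contra hyv
      by_cases hyD : y ∈ D
      · exact hy.2 (hK.closed x hx y ⟨hyD, hyv⟩ hxy)
      · exact hvK ((huniq x (hKD hx) y ⟨hy.1, hyD⟩ hxy).1 ▸ hx)
    have hcard : k ≤ K.ncard := by
      rw [← hA]
      exact Set.ncard_le_ncard (hK.subset_of_connected hc hAD ha haK)
    have hlt : K.ncard < n := by
      rw [← hn]
      exact Set.ncard_lt_ncard ⟨hKD, fun h => hvK (h hv)⟩
    by_cases hex : ∃ x ∈ K, G.Adj x v
    · obtain ⟨x, hx, hxv⟩ := hex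
      refine ih _ hlt K (hKD.trans hDS) rfl hK.connected hcard x hx v ?_
      intro x' hx' y hy hxy
      obtain rfl := hout x' hx' y hy hxy
      exact ⟨hG.eq_of_adj_connected hK.connected hx' hx hvK hxy hxv, rfl⟩
    · push Not at hex
      refine ih _ hlt K (hKD.trans hDS) rfl hK.connected hcard a haK v ?_
      intro x' hx' y hy hxy
      obtain rfl := hout x' hx' y hy hxy
      exact absurd hxy (hex x' hx')

/-- In a forest every vertex set `S` contains a generalized `k`-independent set with at least
`(k - 1) / k * |S|` elements; if this is not strict then all components of `S` belong to the
families of trees `InR k`. -/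
theorem exists_isGenIndepSet_of_isAcyclic [Finite V] (hG : G.IsAcyclic) {k : ℕ}
    (S : Set V) : ∃ I ⊆ S, IsGenIndepSet G k I ∧ k * S.ncard ≤ k * I.ncard + S.ncard ∧
      (k * S.ncard = k * I.ncard + S.ncard →
        ∀ K, IsComponentIn G S K → ∃ i, InR k i (G.induce K)) := by
  induction hn : S.ncard using Nat.strong_induction_on generalizing S with
  | _ n ih =>
    subst hn
    by_cases hS : IsGenIndepSet G k S
    · refine ⟨S, subset_rfl, hS, by omega, fun h K hK => ?_⟩
      have h0 : S = ∅ := (Set.ncard_eq_zero).1 (by omega)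
      obtain ⟨⟨a, ha⟩⟩ := hK.connected.nonempty
      have := hK.subset ha
      simp [h0] at this
    obtain ⟨D, hDS, hD, hkD, v, hv, w, huniq, hI⟩ := exists_branch hG hS
    have hSD := Set.ncard_sdiff_add_ncard_of_subset hDS
    have hDv := Set.ncard_sdiff_singleton_add_one hv
    obtain ⟨I, hIS, hII, hle, hcomp⟩ := ih (S \ D).ncard (by omega) (S \ D) rfl
    have hdisj : Disjoint I (D \ {v}) :=
      Set.disjoint_left.2 fun x hx hx' => (hIS hx).2 hx'.1
    refine ⟨I ∪ D \ {v}, Set.union_subset (hIS.trans Set.sdiff_subset)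
      (Set.sdiff_subset.trans hDS), hII.union hI ?_, ?_, ?_⟩
    · intro x hx y hy hxy
      exact hy.2 (huniq y hy.1 x (hIS hx) hxy.symm).1
    · rw [Set.ncard_union_eq hdisj, ← hSD, ← hDv]
      rw [← hDv] at hkD
      nlinarith
    · rw [Set.ncard_union_eq hdisj, ← hSD, ← hDv]
      rw [← hDv] at hkD
      intro heq K hK
      -- Equality is the sum of the inequality for `S \ D` and of `k ≤ |D|`, so both are tight.
      have hDk : D.ncard = k := by
        rw [← hDv]
        nlinarith
      have hcomp := hcomp (by nlinarith)
      by_cases hKD : D ⊆ K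
      · by_cases hex : ∃ x ∈ D, ∃ y ∈ K \ D, G.Adj x y
        · obtain ⟨x, hx, y, hy, hxy⟩ := hex
          obtain ⟨rfl, rfl⟩ := huniq x hx y ⟨hK.subset hy.1, hy.2⟩ hxy
          obtain ⟨L, hL, hyL⟩ := exists_isComponentIn (G := G) (S := K \ D) hy
          -- `K \ D` stays connected, because `D` is attached to it only at `y`.
          have hKL : K \ D ⊆ L := by
            have : K ⊆ L ∪ D := by
              refine subset_of_connected_of_closed hK.connected hy.1 (Or.inl hyL) ?_
              rintro a haK (haL | haD) b hb hab
              · by_cases hbD : b ∈ D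
                · exact Or.inr hbD
                · exact Or.inl (hL.closed a haL b ⟨hb, hbD⟩ hab)
              · by_cases hbD : b ∈ D
                · exact Or.inr hbD
                · exact Or.inl ((huniq a haD b ⟨hK.subset hb, hbD⟩ hab).2 ▸ hyL)
            exact fun z hz => (this hz.1).resolve_right hz.2
          obtain rfl : L = K \ D := hL.subset.antisymm hKL
          obtain ⟨i, hi⟩ := hcomp (K \ D) ⟨Set.sdiff_subset_sdiff_left hK.subset, hL.connected,
            fun a ha b hb hab => ⟨hK.closed a ha.1 b hb.1 hab, hb.2⟩⟩
          exact ⟨i + 1, hi.induce_of_diff hG hKD hD hDk hx hy hxy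
            fun a ha b hb => huniq a ha b ⟨hK.subset hb.1, hb.2⟩⟩
        · push Not at hex
          have hKD' : K ⊆ D := by
            refine subset_of_connected_of_closed hK.connected (hKD hv) hv ?_
            intro x _ hx y hy hxy
            by_contra hyD
            exact hex x hx y ⟨hy, hyD⟩ hxy
          obtain rfl := hKD'.antisymm hKD
          exact ⟨1, inR_one_of_connected hG hD hDk⟩
      -- The connected set `D` lies in a single component of `S`, so it is disjoint from `K`.
      · have hdis : ∀ x ∈ K, x ∉ D := fun x hx hxD =>
          hKD (hK.subset_of_connected hD hDS hxD hx)
        exact hcomp K ⟨fun x hx => ⟨hK.subset hx, hdis x hx⟩, hK.connected,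
          fun x hx y hy hxy => hK.closed x hx y hy.1 hxy⟩

/-- If every edge of `G` that avoids `X` belongs to a forest `F`, then the bound for forests
applies to the complement of `X`. -/
theorem genIndepNum_bound_of_cover [Finite V] {F : SimpleGraph V} (hF : F.IsAcyclic)
    (hFG : F ≤ G) {X : Set V} (hX : ∀ a b, G.Adj a b → a ∉ X → b ∉ X → F.Adj a b)
    (k : ℕ) :
    k * Xᶜ.ncard ≤ k * genIndepNum G k + Xᶜ.ncard ∧
      (k * Xᶜ.ncard = k * genIndepNum G k + Xᶜ.ncard →
        ∀ K, IsComponentIn G Xᶜ K → ∃ i, InR k i (G.induce K)) := by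
  have hind : ∀ A ⊆ Xᶜ, F.induce A = G.induce A := by
    intro A hA
    ext a b
    exact ⟨fun h => hFG h, fun h => hX a b h (hA a.2) (hA b.2)⟩
  obtain ⟨I, hIX, hI, hle, heq⟩ := exists_isGenIndepSet_of_isAcyclic hF (k := k) Xᶜ
  have hIG : IsGenIndepSet G k I := by
    rw [isGenIndepSet_iff] at hI ⊢
    intro A hA hAk
    rw [← hind A (hA.trans hIX)]
    exact hI A hA hAk
  have hα := Nat.mul_le_mul_left k hIG.ncard_le
  refine ⟨by omega, fun h K hK => ?_⟩
  rw [← hind K hK.subset]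
  refine heq (by omega) K ⟨hK.subset, ?_, fun x hx y hy hxy => hK.closed x hx y hy (hFG hxy)⟩
  rw [hind K hK.subset]
  exact hK.connected

/-! ### The dimension of the cycle space -/

/-- `F` has `|V| - c(F)` edges, and a spanning subgraph has at least as many components as `G`. -/
lemma cycleDim_le_of_isAcyclic [Finite V] {F : SimpleGraph V} (hF : F.IsAcyclic) (hFG : F ≤ G) :
    cycleDim G ≤ ((G.edgeSet \ F.edgeSet).ncard : ℤ) := by
  have h1 := hF.ncard_edgeSet_add_card_connectedComponent
  have h2 := Set.ncard_sdiff_add_ncard_of_subset (edgeSet_mono hFG)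
  have h3 : Nat.card G.ConnectedComponent ≤ Nat.card F.ConnectedComponent := by
    refine Nat.card_le_card_of_surjective (ConnectedComponent.map (Hom.ofLE hFG)) ?_
    intro C
    induction C using ConnectedComponent.ind with | _ v =>
    exact ⟨F.connectedComponentMk v, rfl⟩
  unfold cycleDim
  omega

lemma cycleDim_eq_of_isAcyclic [Finite V] {F : SimpleGraph V} (hF : F.IsAcyclic) (hFG : F ≤ G)
    (hr : F.Reachable = G.Reachable) :
    cycleDim G = ((G.edgeSet \ F.edgeSet).ncard : ℤ) := by
  have h1 := hF.ncard_edgeSet_add_card_connectedComponent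
  have h2 := Set.ncard_sdiff_add_ncard_of_subset (edgeSet_mono hFG)
  have h3 : Nat.card G.ConnectedComponent = Nat.card F.ConnectedComponent := by
    unfold ConnectedComponent
    rw [hr]
  unfold cycleDim
  omega

lemma reachable_deleteEdges_eq {v w : V} (h : (G.deleteEdges {s(v, w)}).Reachable v w) :
    (G.deleteEdges {s(v, w)}).Reachable = G.Reachable := by
  ext a b
  refine ⟨fun hab => hab.mono (deleteEdges_le _), ?_⟩
  rintro ⟨p⟩
  induction p with
  | nil => exact Reachable.refl _
  | @cons x y z hxy p ih =>
    refine Reachable.trans ?_ ih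
    by_cases he : s(x, y) = s(v, w)
    · rcases Sym2.eq_iff.1 he with ⟨rfl, rfl⟩ | ⟨rfl, rfl⟩
      · exact h
      · exact h.symm
    · exact Adj.reachable (by rw [deleteEdges_adj]; exact ⟨hxy, he⟩)

/-- The lower bound for `genIndepNum` obtained from a spanning forest and a vertex cover of the
remaining edges. -/
lemma le_genIndepNum_of_cover [Finite V] {F : SimpleGraph V} (hF : F.IsAcyclic)
    (hFG : F ≤ G) {X : Set V} (hX : ∀ a b, G.Adj a b → a ∉ X → b ∉ X → F.Adj a b) (k : ℕ) :
    ((k : ℤ) - 1) * ((Nat.card V : ℤ) - X.ncard) ≤ k * genIndepNum G k := by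
  have h := (genIndepNum_bound_of_cover hF hFG hX k).1
  have h2 := Set.ncard_add_ncard_compl X
  have h3 : ((Nat.card V : ℤ) - X.ncard) = (Xᶜ.ncard : ℤ) := by omega
  rw [h3]
  zify at h
  linarith

lemma adj_of_notMem_cover {F : SimpleGraph V} {X : Set V}
    (hX : ∀ e ∈ G.edgeSet \ F.edgeSet, ∃ v ∈ e, v ∈ X) (a b : V) (hab : G.Adj a b)
    (ha : a ∉ X) (hb : b ∉ X) : F.Adj a b := by
  by_contra h
  obtain ⟨v, hv, hvX⟩ := hX s(a, b) ⟨hab, h⟩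
  rcases Sym2.mem_iff.1 hv with rfl | rfl
  · exact ha hvX
  · exact hb hvX

theorem le_genIndepNum [Finite V] (G : SimpleGraph V) {k : ℕ} (hk : 1 ≤ k) :
    ((k : ℤ) - 1) * ((Nat.card V : ℤ) - cycleDim G) ≤ k * genIndepNum G k := by
  obtain ⟨F, hFG, hF, hr⟩ := G.exists_isAcyclic_reachable_eq_le
  -- `Quot.out` picks an arbitrary endpoint of each edge outside the forest.
  have h := le_genIndepNum_of_cover hF hFG
    (adj_of_notMem_cover (X := (fun e => (Quot.out e).1) '' (G.edgeSet \ F.edgeSet))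
      fun e he => ⟨_, Sym2.out_fst_mem e, e, he, rfl⟩) k
  refine le_trans (mul_le_mul_of_nonneg_left ?_ (by omega)) h
  rw [cycleDim_eq_of_isAcyclic hF hFG hr]
  have := Set.ncard_image_le (f := fun e : Sym2 V => (Quot.out e).1)
    (Set.toFinite (G.edgeSet \ F.edgeSet))
  omega

/-! ### Cycles as subgraphs -/

lemma toSubgraph_le_of_edges {H : G.Subgraph} {a b : V} (p : G.Walk a b) (ha : a ∈ H.verts)
    (h : ∀ v ∈ H.verts, ∀ y, s(v, y) ∈ p.edges → H.Adj v y) : p.toSubgraph ≤ H := by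
  induction p with
  | nil => simpa [Walk.toSubgraph] using ha
  | @cons x y z hxy p ih =>
    have hadj : H.Adj x y := h x ha y (by simp)
    simp only [Walk.toSubgraph, sup_le_iff]
    exact ⟨subgraphOfAdj_le_of_adj _ hadj, ih (H.edge_vert hadj.symm)
      fun v hv y hy => h v hv y (by simp [hy])⟩

lemma exists_adj_of_not_toSubgraph_le {H : G.Subgraph} {a u : V} (c : G.Walk a a)
    (hu : u ∈ c.support) (huH : u ∈ H.verts) (hc : ¬ c.toSubgraph ≤ H) :
    ∃ v ∈ H.verts, ∃ y, s(v, y) ∈ c.edges ∧ ¬ H.Adj v y := by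
  classical
  by_contra hcon
  push Not at hcon
  apply hc
  rw [← c.toSubgraph_rotate hu]
  exact toSubgraph_le_of_edges _ huH fun v hv y hy =>
    hcon v hv y ((c.rotate_edges u hu).mem_iff.1 hy)

/-- If two different cycles have a common vertex, the bound is strict: two edges outside a
suitable spanning forest share a vertex, which saves one vertex in the cover of these edges. -/
lemma lt_genIndepNum_of_common_vertex [Finite V] {k : ℕ} (hk : 2 ≤ k) {a b u : V}
    {c : G.Walk a a} {d : G.Walk b b} (hc : c.IsCycle) (hd : d.IsCycle)
    (hle : ¬ c.toSubgraph ≤ d.toSubgraph) (huc : u ∈ c.support) (hud : u ∈ d.support) :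
    ((k : ℤ) - 1) * ((Nat.card V : ℤ) - cycleDim G) < k * genIndepNum G k := by
  obtain ⟨v, hv, y, hvy, hdvy⟩ := exists_adj_of_not_toSubgraph_le c huc
    ((d.mem_verts_toSubgraph).2 hud) hle
  rw [Walk.mem_verts_toSubgraph] at hv
  rw [Walk.adj_toSubgraph_iff_mem_edges] at hdvy
  obtain ⟨e, hed, hve⟩ := (Walk.mem_support_iff_exists_mem_edges_of_not_nil hd.not_nil).1 hv
  obtain ⟨z, rfl⟩ := hve
  -- The edge `vy` lies on `c` but not on `d`. Deleting it therefore preserves reachability and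
  -- leaves `d` intact, so the edge `vz` of `d` can be deleted next in the same way.
  set G₁ := G.deleteEdges {s(v, y)} with hG₁
  have hr₁ : G₁.Reachable = G.Reachable := reachable_deleteEdges_eq
    (adj_and_reachable_delete_edges_iff_exists_cycle.2 ⟨a, c, hc, hvy⟩).2
  have htr : ∀ e ∈ d.edges, e ∈ G₁.edgeSet := by
    intro e he
    rw [hG₁, edgeSet_deleteEdges]
    refine ⟨d.edges_subset_edgeSet he, ?_⟩
    rintro rfl
    exact hdvy he
  set G₂ := G₁.deleteEdges {s(v, z)} with hG₂
  have hr₂ : G₂.Reachable = G₁.Reachable := reachable_deleteEdges_eq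
    (adj_and_reachable_delete_edges_iff_exists_cycle.2
      ⟨b, d.transfer G₁ htr, hd.transfer htr, by simpa using hed⟩).2
  obtain ⟨F, hFG₂, hF, hr⟩ := G₂.exists_isAcyclic_reachable_eq_le
  have hFG : F ≤ G := hFG₂.trans ((deleteEdges_le _).trans (deleteEdges_le _))
  set E := G.edgeSet \ F.edgeSet with hE
  have he₁ : s(v, y) ∈ E := by
    refine ⟨c.edges_subset_edgeSet hvy, fun h => ?_⟩
    have := edgeSet_mono hFG₂ h
    simp [hG₂, hG₁] at this
  have he₂ : s(v, z) ∈ E \ {s(v, y)} := by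
    refine ⟨⟨d.edges_subset_edgeSet hed, fun h => ?_⟩, ?_⟩
    · have := edgeSet_mono hFG₂ h
      simp [hG₂] at this
    · intro h
      exact hdvy (Set.mem_singleton_iff.1 h ▸ hed)
  have hn₁ := Set.ncard_sdiff_singleton_add_one he₁
  have hn₂ := Set.ncard_sdiff_singleton_add_one he₂
  set E' := (E \ {s(v, y)}) \ {s(v, z)} with hE'
  have hn := Set.ncard_image_le (f := fun e : Sym2 V => (Quot.out e).1) (Set.toFinite E')
  have hins := Set.ncard_insert_le v ((fun e : Sym2 V => (Quot.out e).1) '' E')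
  -- The single vertex `v` covers both `vy` and `vz`, so the cover has fewer vertices than there are
  -- edges outside `F`.
  have h := le_genIndepNum_of_cover hF hFG
    (adj_of_notMem_cover (X := insert v ((fun e => (Quot.out e).1) '' E')) ?_) k
  · refine lt_of_lt_of_le (mul_lt_mul_of_pos_left ?_ (by omega)) h
    rw [cycleDim_eq_of_isAcyclic hF hFG (hr.trans (hr₂.trans hr₁)), ← hE]
    omega
  · intro e he
    by_cases h1 : e = s(v, y)
    · exact ⟨v, by simp [h1], by simp⟩
    by_cases h2 : e = s(v, z)
    · exact ⟨v, by simp [h2], by simp⟩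
    exact ⟨_, Sym2.out_fst_mem e, Or.inr ⟨e, ⟨⟨he, h1⟩, h2⟩, rfl⟩⟩

theorem cyclesDisjoint_of_genIndepNum_eq [Finite V] {k : ℕ} (hk : 2 ≤ k)
    (h : (k : ℤ) * genIndepNum G k = ((k : ℤ) - 1) * ((Nat.card V : ℤ) - cycleDim G)) :
    CyclesDisjoint G := by
  intro a b c d hc hd hne
  rw [Set.disjoint_left]
  intro u huc hud
  rw [Walk.mem_verts_toSubgraph] at huc hud
  by_cases hle : c.toSubgraph ≤ d.toSubgraph
  · have hle' : ¬ d.toSubgraph ≤ c.toSubgraph := fun h' => hne (le_antisymm hle h')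
    exact (lt_genIndepNum_of_common_vertex hk hd hc hle' hud huc).ne' h
  · exact (lt_genIndepNum_of_common_vertex hk hc hd hle huc hud).ne' h

/-- The subgraphs of `G` that are cycles. -/
def cycleSubgraphs (G : SimpleGraph V) : Set G.Subgraph :=
  {H | ∃ (u : V) (c : G.Walk u u), c.IsCycle ∧ c.toSubgraph = H}

lemma mem_nonCycleVerts_iff {v : V} :
    v ∈ nonCycleVerts G ↔ ∀ H ∈ cycleSubgraphs G, v ∉ H.verts := by
  constructor
  · rintro h _ ⟨u, c, hc, rfl⟩ hv
    exact h u c hc ((c.mem_verts_toSubgraph).1 hv)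
  · intro h u c hc hv
    exact h _ ⟨u, c, hc, rfl⟩ ((c.mem_verts_toSubgraph).2 hv)

lemma CyclesDisjoint.eq_of_mem (hG : CyclesDisjoint G) {H H' : G.Subgraph}
    (hH : H ∈ cycleSubgraphs G) (hH' : H' ∈ cycleSubgraphs G) {v : V} (hv : v ∈ H.verts)
    (hv' : v ∈ H'.verts) : H = H' := by
  obtain ⟨u, c, hc, rfl⟩ := hH
  obtain ⟨u', c', hc', rfl⟩ := hH'
  by_contra hne
  exact Set.disjoint_left.1 (hG u u' c c' hc hc' hne) hv hv'

/-- Every cycle has an edge outside a spanning forest, and disjoint cycles yield different edges. -/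
lemma CyclesDisjoint.ncard_le_cycleDim [Finite V] (hG : CyclesDisjoint G) :
    ((cycleSubgraphs G).ncard : ℤ) ≤ cycleDim G := by
  obtain ⟨F, hFG, hF, hr⟩ := G.exists_isAcyclic_reachable_eq_le
  rw [cycleDim_eq_of_isAcyclic hF hFG hr]
  have hex : ∀ H : cycleSubgraphs G, ∃ e : ↥(G.edgeSet \ F.edgeSet),
      (e : Sym2 V) ∈ H.1.edgeSet := by
    rintro ⟨_, u, c, hc, rfl⟩
    have : ∃ e ∈ c.edges, e ∉ F.edgeSet := by
      by_contra hcon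
      push Not at hcon
      exact hF _ (hc.transfer hcon)
    obtain ⟨e, he, heF⟩ := this
    exact ⟨⟨e, c.edges_subset_edgeSet he, heF⟩, by simpa using he⟩
  choose f hf using hex
  have hinj : Function.Injective f := by
    intro H H' h
    have hv := Sym2.out_fst_mem (f H : Sym2 V)
    exact Subtype.ext (hG.eq_of_mem H.2 H'.2 (H.1.mem_verts_of_mem_edge (hf H) hv)
      (H'.1.mem_verts_of_mem_edge (hf H') (h ▸ hv)))
  rw [← Nat.card_coe_set_eq, ← Nat.card_coe_set_eq]
  exact_mod_cast Nat.card_le_card_of_injective f hinj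

/-- Deleting one chosen edge from every cycle leaves a forest. Disjointness plays no role in this
direction. -/
lemma cycleDim_le_ncard [Finite V] : cycleDim G ≤ ((cycleSubgraphs G).ncard : ℤ) := by
  have hex : ∀ H : cycleSubgraphs G, ∃ e : Sym2 V, e ∈ H.1.edgeSet := by
    rintro ⟨_, u, c, hc, rfl⟩
    obtain ⟨e, he, -⟩ := (Walk.mem_support_iff_exists_mem_edges_of_not_nil hc.not_nil).1
      c.start_mem_support
    exact ⟨e, by simpa using he⟩
  choose f hf using hex
  have hF : (G.deleteEdges (Set.range f)).IsAcyclic := by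
    intro u c hc
    have hc' := hc.mapLe (deleteEdges_le (Set.range f))
    have h1 := hf ⟨_, u, _, hc', rfl⟩
    rw [Walk.edgeSet_toSubgraph, Walk.mem_edgeSet, Walk.edges_mapLe_eq_edges] at h1
    have h2 := c.edges_subset_edgeSet h1
    rw [edgeSet_deleteEdges] at h2
    exact h2.2 ⟨_, rfl⟩
  refine (cycleDim_le_of_isAcyclic hF (deleteEdges_le _)).trans ?_
  have h1 : G.edgeSet \ (G.deleteEdges (Set.range f)).edgeSet ⊆ Set.range f := by
    rw [edgeSet_deleteEdges]
    intro e he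
    by_contra h
    exact he.2 ⟨he.1, h⟩
  have h2 := Set.ncard_le_ncard h1
  have h3 : (Set.range f).ncard ≤ (cycleSubgraphs G).ncard := by
    rw [← Nat.card_coe_set_eq, ← Nat.card_coe_set_eq]
    exact Finite.card_range_le f
  exact_mod_cast h2.trans h3

/-! ### Necessity of the conditions -/

lemma notMem_of_mem_cycle_support {F : SimpleGraph V} {X : Set V} (hFG : F ≤ G)
    (hF : ∀ a b, F.Adj a b → a ∉ X) {u : V} {c : F.Walk u u} (hc : c.IsCycle) {v : V}
    (hv : v ∈ (c.mapLe hFG).toSubgraph.verts) : v ∉ X := by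
  rw [Walk.mem_verts_toSubgraph, Walk.support_mapLe_eq_support] at hv
  obtain ⟨e, he, hve⟩ := (Walk.mem_support_iff_exists_mem_edges_of_not_nil hc.not_nil).1 hv
  obtain ⟨z, rfl⟩ := hve
  exact hF v z (c.adj_of_mem_edges he)

/-- If equality holds and `X` consists of one vertex from each cycle, then the components of the
complement of `X` belong to the families of trees `InR k`. -/
lemma exists_inR_of_transversal [Finite V] {k : ℕ} (hk : 1 ≤ k) (hG : CyclesDisjoint G)
    (h : (k : ℤ) * genIndepNum G k = ((k : ℤ) - 1) * ((Nat.card V : ℤ) - cycleDim G))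
    (t : cycleSubgraphs G → V) (ht : ∀ H, t H ∈ H.1.verts) {K : Set V}
    (hK : IsComponentIn G (Set.range t)ᶜ K) : ∃ i, InR k i (G.induce K) := by
  -- `F` is `G` with the transversal made isolated. It is acyclic because each cycle of `G` passes
  -- through its own transversal vertex.
  let F : SimpleGraph V :=
    { Adj := fun a b => G.Adj a b ∧ a ∉ Set.range t ∧ b ∉ Set.range t
      symm := ⟨fun a b h => ⟨h.1.symm, h.2.2, h.2.1⟩⟩
      loopless := ⟨fun a h => G.loopless.irrefl a h.1⟩ }
  have hFG : F ≤ G := fun a b h => h.1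
  have hF : F.IsAcyclic := by
    intro u c hc
    have hH : (c.mapLe hFG).toSubgraph ∈ cycleSubgraphs G := ⟨u, _, hc.mapLe hFG, rfl⟩
    exact notMem_of_mem_cycle_support hFG (fun a b h => h.2.1) hc (ht ⟨_, hH⟩) ⟨_, rfl⟩
  have hX : ∀ a b, G.Adj a b → a ∉ Set.range t → b ∉ Set.range t → F.Adj a b :=
    fun a b hab ha hb => ⟨hab, ha, hb⟩
  refine (genIndepNum_bound_of_cover hF hFG hX k).2 ?_ K hK
  have h1 := le_genIndepNum_of_cover hF hFG hX k
  have h2 := Set.ncard_add_ncard_compl (Set.range t)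
  have h3 : (Set.range t).ncard ≤ (cycleSubgraphs G).ncard := by
    rw [← Nat.card_coe_set_eq, ← Nat.card_coe_set_eq]
    exact Finite.card_range_le t
  have h4 := hG.ncard_le_cycleDim
  -- The transversal has at most `ω(G)` vertices, so the assumed equality squeezes the forest bound
  -- into an equality too.
  have h5 : (Nat.card V : ℤ) - cycleDim G ≤ (Nat.card V : ℤ) - (Set.range t).ncard := by omega
  have h6 := mul_le_mul_of_nonneg_left h5 (show (0 : ℤ) ≤ (k : ℤ) - 1 by omega)
  have h7 : ((Nat.card V : ℤ) - (Set.range t).ncard) = ((Set.range t)ᶜ.ncard : ℤ) := by omega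
  rw [h7] at h1 h6
  zify
  linarith

/-- A connected set disjoint from a cycle is adjacent to at most one vertex of the cycle, when
the cycles of the graph are pairwise disjoint. -/
lemma CyclesDisjoint.eq_of_adj (hG : CyclesDisjoint G) {H : G.Subgraph}
    (hH : H ∈ cycleSubgraphs G) {K : Set V} (hK : (G.induce K).Connected)
    (hKH : Disjoint K H.verts) {x y x' y' : V} (hx : x ∈ K) (hy : y ∈ H.verts)
    (hx' : x' ∈ K) (hy' : y' ∈ H.verts) (hxy : G.Adj x y) (hxy' : G.Adj x' y') : y = y' := by
  by_contra hne
  obtain ⟨u, c, hc, rfl⟩ := hH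
  have hyK : y ∉ K := fun h => Set.disjoint_left.1 hKH h hy
  have hxc : x ∉ c.toSubgraph.verts := Set.disjoint_left.1 hKH hx
  -- The edge `xy` is not a bridge: go from `x` to `x'` inside `K`, cross to `y'`, and return to `y`
  -- along the cycle. So `xy` lies on a cycle, which meets `c` at `y` and hence equals it, although
  -- `x` is not on `c`.
  have hr : (G.deleteEdges {s(x, y)}).Reachable x y := by
    have h1 : (G.deleteEdges {s(x, y)}).Reachable x x' := by
      rw [Sym2.eq_swap]
      exact reachable_deleteEdges_of_connected hK hx hx' hyK x
    have h2 : (G.deleteEdges {s(x, y)}).Reachable y' y :=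
      reachable_deleteEdges_of_connected c.toSubgraph_connected.induce_verts hy' hy hxc y
    refine (h1.trans (Adj.reachable ?_)).trans h2
    rw [deleteEdges_adj]
    refine ⟨hxy', fun h => ?_⟩
    rcases Sym2.eq_iff.1 (Set.mem_singleton_iff.1 h) with ⟨-, h⟩ | ⟨h, -⟩
    · exact hne h.symm
    · exact hyK (h ▸ hx')
  obtain ⟨w, d, hd, hed⟩ := adj_and_reachable_delete_edges_iff_exists_cycle.1 ⟨hxy, hr⟩
  have hxd : x ∈ d.toSubgraph.verts := by
    rw [Walk.mem_verts_toSubgraph]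
    exact d.fst_mem_support_of_mem_edges hed
  have hyd : y ∈ d.toSubgraph.verts := by
    rw [Walk.mem_verts_toSubgraph]
    exact d.snd_mem_support_of_mem_edges hed
  have heq : c.toSubgraph = d.toSubgraph :=
    hG.eq_of_mem ⟨u, c, hc, rfl⟩ ⟨w, d, hd, rfl⟩ hy hyd
  exact hxc (heq ▸ hxd)

/-- If equality holds and `W` contains all vertices outside the cycles and, from each cycle,
no vertex or all vertices but one, then the components of `W` belong to the families of trees
`InR k`. -/
lemma exists_inR_of_isComponentIn [Finite V] {k : ℕ} (hk : 1 ≤ k) (hG : CyclesDisjoint G)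
    (h : (k : ℤ) * genIndepNum G k = ((k : ℤ) - 1) * ((Nat.card V : ℤ) - cycleDim G))
    {W : Set V} (hW : nonCycleVerts G ⊆ W)
    (hW' : ∀ H ∈ cycleSubgraphs G,
      Disjoint H.verts W ∨ ∃ x ∈ H.verts, x ∉ W ∧ H.verts ⊆ insert x W)
    {K : Set V} (hK : IsComponentIn G W K) : ∃ i, InR k i (G.induce K) := by
  -- The chosen vertex of each cycle is the only one outside `W` that can be adjacent to `K`.
  -- Removing just these vertices then leaves `K` a full component.
  have hex : ∀ H : cycleSubgraphs G, ∃ x, x ∈ H.1.verts ∧ x ∉ W ∧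
      ∀ y ∈ H.1.verts, y ∉ W → (∃ a ∈ K, G.Adj a y) → y = x := by
    rintro ⟨H, hH⟩
    rcases hW' H hH with hd | ⟨x, hx, hxW, hsub⟩
    · by_cases hadj : ∃ x ∈ H.verts, ∃ a ∈ K, G.Adj a x
      · obtain ⟨x, hx, a, ha, hax⟩ := hadj
        refine ⟨x, hx, Set.disjoint_left.1 hd hx, ?_⟩
        rintro y hy - ⟨b, hb, hby⟩
        exact hG.eq_of_adj hH hK.connected (hd.symm.mono_left hK.subset) hb hy ha hx hby hax
      · have hne : H.verts.Nonempty := by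
          obtain ⟨u, c, hc, rfl⟩ := hH
          exact ⟨u, c.start_mem_verts_toSubgraph⟩
        obtain ⟨x, hx⟩ := hne
        exact ⟨x, hx, Set.disjoint_left.1 hd hx, fun y hy _ hya => absurd ⟨y, hy, hya⟩ hadj⟩
    · exact ⟨x, hx, hxW, fun y hy hyW _ => (hsub hy).resolve_right hyW⟩
  choose t ht htW htu using hex
  refine exists_inR_of_transversal hk hG h t ht ⟨?_, hK.connected, ?_⟩
  · rintro x hx ⟨H, rfl⟩
    exact htW H (hK.subset hx)
  · intro x hx y hy hxy
    by_cases hyW : y ∈ W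
    · exact hK.closed x hx y hyW hxy
    · exfalso
      have hyc : y ∉ nonCycleVerts G := fun h => hyW (hW h)
      rw [mem_nonCycleVerts_iff] at hyc
      push Not at hyc
      obtain ⟨H, hH, hyH⟩ := hyc
      exact hy ⟨⟨H, hH⟩, (htu ⟨H, hH⟩ y hyH hyW ⟨x, hx, hxy⟩).symm⟩

lemma dvd_ncard_of_forall_isComponentIn [Finite V] {k : ℕ} {W : Set V}
    (h : ∀ K, IsComponentIn G W K → ∃ i, InR k i (G.induce K)) : k ∣ W.ncard := by
  classical
  have := Fintype.ofFinite (G.induce W).ConnectedComponent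
  rw [← Nat.card_coe_set_eq, card_eq_sum_card_connectedComponent (G.induce W)]
  refine Finset.dvd_sum fun C _ => ?_
  obtain ⟨i, hi⟩ := h _ (isComponentIn_image_supp W C)
  exact ⟨i, (hi.of_iso (componentIso W C)).card_eq⟩

lemma disjoint_nonCycleVerts {H : G.Subgraph} (hH : H ∈ cycleSubgraphs G) :
    Disjoint H.verts (nonCycleVerts G) :=
  Set.disjoint_left.2 fun _ hv hv' => mem_nonCycleVerts_iff.1 hv' H hH hv

/-- Indices start at `1` because the base point occurs at both `0` and `c.length`; on this range
`getVert` is injective. -/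
lemma verts_eq_image_getVert {v : V} (c : G.Walk v v) (hc : c.IsCycle) :
    c.toSubgraph.verts = c.getVert '' {i | 1 ≤ i ∧ i ≤ c.length} := by
  ext x
  rw [Walk.mem_verts_toSubgraph, Walk.mem_support_iff_exists_getVert]
  constructor
  · rintro ⟨i, rfl, hi⟩
    rcases Nat.eq_zero_or_pos i with rfl | h
    · refine ⟨c.length, ⟨by have := hc.three_le_length; omega, le_rfl⟩, by simp⟩
    · exact ⟨i, ⟨h, hi⟩, rfl⟩
  · rintro ⟨i, hi, rfl⟩
    exact ⟨i, rfl, hi.2⟩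

lemma ncard_verts_toSubgraph {v : V} (c : G.Walk v v) (hc : c.IsCycle) :
    c.toSubgraph.verts.ncard = c.length := by
  rw [verts_eq_image_getVert c hc, hc.getVert_injOn.ncard_image,
    show {i | 1 ≤ i ∧ i ≤ c.length} = (Finset.Icc 1 c.length : Set ℕ) by ext; simp,
    Set.ncard_coe_finset]
  simp

/-- Both the set of non-cycle vertices and its union with the cycle minus one vertex split into
components of size divisible by `k`. The difference, `c.length - 1`, is then divisible by `k`. -/
theorem length_modEq_one_of_genIndepNum_eq [Finite V] {k : ℕ} (hk : 1 ≤ k)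
    (hG : CyclesDisjoint G)
    (h : (k : ℤ) * genIndepNum G k = ((k : ℤ) - 1) * ((Nat.card V : ℤ) - cycleDim G))
    {v : V} (c : G.Walk v v) (hc : c.IsCycle) : c.length ≡ 1 [MOD k] := by
  have hH : c.toSubgraph ∈ cycleSubgraphs G := ⟨v, c, hc, rfl⟩
  have hv : v ∈ c.toSubgraph.verts := c.start_mem_verts_toSubgraph
  have hd := disjoint_nonCycleVerts hH
  have h₀ : k ∣ (nonCycleVerts G).ncard := dvd_ncard_of_forall_isComponentIn fun K hK =>
    exists_inR_of_isComponentIn hk hG h subset_rfl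
      (fun H hH => Or.inl (disjoint_nonCycleVerts hH)) hK
  have h₁ : k ∣ (nonCycleVerts G ∪ c.toSubgraph.verts \ {v}).ncard := by
    refine dvd_ncard_of_forall_isComponentIn fun K hK =>
      exists_inR_of_isComponentIn hk hG h Set.subset_union_left (fun H hH' => ?_) hK
    by_cases hHc : H = c.toSubgraph
    · subst hHc
      refine Or.inr ⟨v, hv, ?_, ?_⟩
      · rintro (hv' | hv')
        · exact Set.disjoint_left.1 hd hv hv'
        · exact hv'.2 rfl
      · intro x hx
        by_cases hxv : x = v
        · exact Or.inl hxv
        · exact Or.inr (Or.inr ⟨hx, hxv⟩)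
    · refine Or.inl (Set.disjoint_left.2 ?_)
      rintro x hx (hx' | hx')
      · exact Set.disjoint_left.1 (disjoint_nonCycleVerts hH') hx hx'
      · exact hHc (hG.eq_of_mem hH' hH hx hx'.1)
  rw [Set.ncard_union_eq (hd.symm.mono_right Set.sdiff_subset), Nat.dvd_add_right h₀,
    Set.ncard_sdiff_singleton_of_mem hv, ncard_verts_toSubgraph c hc] at h₁
  exact ((Nat.modEq_iff_dvd' (by have := hc.three_le_length; omega)).2 h₁).symm

theorem inR_of_genIndepNum_eq [Finite V] {k : ℕ} (hk : 1 ≤ k) (hG : CyclesDisjoint G)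
    (h : (k : ℤ) * genIndepNum G k = ((k : ℤ) - 1) * ((Nat.card V : ℤ) - cycleDim G))
    (T : (Gam G).ConnectedComponent) :
    k ∣ Nat.card T ∧ InR k (Nat.card T / k) T.toSimpleGraph := by
  obtain ⟨i, hi⟩ := exists_inR_of_isComponentIn hk hG h subset_rfl
    (fun H hH => Or.inl (disjoint_nonCycleVerts hH)) (isComponentIn_image_supp _ T)
  have hi' := hi.of_iso (componentIso _ T)
  have hcard : Nat.card T = k * i := hi'.card_eq
  rw [hcard, Nat.mul_div_cancel_left _ (by omega)]
  exact ⟨dvd_mul_right _ _, hi'⟩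

/-! ### Sufficiency of the conditions -/

/-- With length `kq + 1`, the claim is that `S` omits at least `q + 1` vertices of the cycle. Start
the cycle at one omitted vertex: the other `kq` vertices form `q` paths on `k` vertices, each
omitting another. -/
lemma ncard_verts_add_le_of_isGenIndepSet [Finite V] {k : ℕ} (hk : 2 ≤ k) {v : V}
    (c : G.Walk v v) (hc : c.IsCycle) (hmod : c.length ≡ 1 [MOD k]) {S : Set V}
    (hS : IsGenIndepSet G k S) :
    c.toSubgraph.verts.ncard + k ≤ k * (Sᶜ ∩ c.toSubgraph.verts).ncard + 1 := by
  classical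
  have h3 := hc.three_le_length
  obtain ⟨q, hq⟩ := (Nat.modEq_iff_dvd' (by omega)).1 hmod.symm
  have hlen : c.length = k * q + 1 := by omega
  have hq0 : 1 ≤ q := by
    rcases Nat.eq_zero_or_pos q with rfl | h
    · omega
    · exact h
  have block : ∀ {w : V} (d : G.Walk w w), d.IsCycle → d.length = k * q + 1 → ∀ j < q,
      ∃ i, k * j + 1 ≤ i ∧ i ≤ k * j + k ∧ d.getVert i ∉ S := by
    intro w d hd hdl j hj
    have hjq : k * j + k ≤ k * q := by
      rw [← Nat.mul_succ]
      exact Nat.mul_le_mul_left k hj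
    by_contra hcon
    push Not at hcon
    refine isGenIndepSet_iff.1 hS (d.getVert '' Set.Icc (k * j + 1) (k * j + k)) ?_ ?_
      (connected_image_Icc (by omega) fun i _ h2 => d.adj_getVert_succ (by omega))
    · rintro _ ⟨i, hi, rfl⟩
      exact hcon i hi.1 hi.2
    · rw [Set.InjOn.ncard_image (hd.getVert_injOn.mono fun i hi => ?_),
        ← Finset.coe_Icc, Set.ncard_coe_finset, Nat.card_Icc]
      · omega
      · exact ⟨by have := hi.1; omega, by have := hi.2; omega⟩
  obtain ⟨i₀, -, -, hi₀⟩ := block c hc hlen 0 hq0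
  set w := c.getVert i₀
  have hw : w ∈ c.support := c.getVert_mem_support i₀
  set d := c.rotate w hw with hd_def
  have hd : d.IsCycle := hc.rotate hw
  have hdl : d.length = k * q + 1 := by rw [hd_def, Walk.length_rotate, hlen]
  choose! t ht₁ ht₂ htS using block d hd hdl
  have hver : d.toSubgraph = c.toSubgraph := c.toSubgraph_rotate hw
  rw [← hver]
  -- Index `q` stands for the base point, read at position `kq + 1`, beyond all the blocks.
  let g : ℕ → ℕ := fun j => if j < q then t j else d.length
  have hg : Set.InjOn (fun j => d.getVert (g j)) (Finset.range (q + 1)) := by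
    have hlt : ∀ i j, i < j → j < q + 1 → g i < g j := by
      intro i j hij hj
      have hi : i < q := by omega
      have h1 := ht₂ i hi
      by_cases hjq : j < q
      · have h2 := ht₁ j hjq
        have : k * i + k ≤ k * j := by
          rw [← Nat.mul_succ]
          exact Nat.mul_le_mul_left k hij
        simp only [g, hi, hjq, if_true]
        omega
      · have : k * i + k ≤ k * q := by
          rw [← Nat.mul_succ]
          exact Nat.mul_le_mul_left k hi
        simp only [g, hi, hjq, if_true, if_false]
        omega
    have hrange : ∀ j, j < q + 1 → 1 ≤ g j ∧ g j ≤ d.length := by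
      intro j hj
      by_cases hjq : j < q
      · have h1 := ht₁ j hjq
        have h2 := ht₂ j hjq
        have : k * j + k ≤ k * q := by
          rw [← Nat.mul_succ]
          exact Nat.mul_le_mul_left k hjq
        simp only [g, hjq, if_true]
        omega
      · simp only [g, hjq, if_false]
        omega
    intro i hi j hj hij
    simp only [Finset.coe_range, Set.mem_Iio] at hi hj
    have := hd.getVert_injOn (hrange i hi) (hrange j hj) hij
    rcases lt_trichotomy i j with h | h | h
    · exact absurd this (hlt i j h hj).ne
    · exact h
    · exact absurd this (hlt j i h hi).ne'
  have hsub : (fun j => d.getVert (g j)) '' (Finset.range (q + 1)) ⊆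
      Sᶜ ∩ d.toSubgraph.verts := by
    rintro _ ⟨j, -, rfl⟩
    refine ⟨?_, (d.mem_verts_toSubgraph).2 (d.getVert_mem_support _)⟩
    by_cases hjq : j < q
    · simpa only [g, hjq, if_true, Set.mem_compl_iff] using htS j hjq
    · simpa only [g, hjq, if_false, Walk.getVert_length, Set.mem_compl_iff] using hi₀
  have hcard := Set.ncard_le_ncard hsub
  rw [hg.ncard_image, Set.ncard_coe_finset, Finset.card_range] at hcard
  have := Nat.mul_le_mul_left k hcard
  rw [ncard_verts_toSubgraph d hd, hdl]
  linarith

lemma CyclesDisjoint.ncard_eq [Finite V] (hG : CyclesDisjoint G) [Fintype (cycleSubgraphs G)]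
    (A : Set V) : A.ncard = (A ∩ nonCycleVerts G).ncard +
      ∑ H : cycleSubgraphs G, (A ∩ H.1.verts).ncard := by
  have h1 : A = (A ∩ nonCycleVerts G) ∪ ⋃ H : cycleSubgraphs G, A ∩ H.1.verts := by
    ext x
    simp only [Set.mem_union, Set.mem_inter_iff, Set.mem_iUnion, mem_nonCycleVerts_iff,
      Subtype.exists]
    constructor
    · intro hx
      by_cases h : ∀ H ∈ cycleSubgraphs G, x ∉ H.verts
      · exact Or.inl ⟨hx, h⟩
      · push Not at h
        obtain ⟨H, hH, hxH⟩ := h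
        exact Or.inr ⟨H, hH, hx, hxH⟩
    · rintro (h | ⟨_, _, h, _⟩)
      · exact h.1
      · exact h
  have h2 : Disjoint (A ∩ nonCycleVerts G) (⋃ H : cycleSubgraphs G, A ∩ H.1.verts) := by
    rw [Set.disjoint_iUnion_right]
    exact fun H => ((disjoint_nonCycleVerts H.2).symm.mono Set.inter_subset_right
      Set.inter_subset_right)
  have h3 : (⋃ H : cycleSubgraphs G, A ∩ H.1.verts).ncard =
      ∑ H : cycleSubgraphs G, (A ∩ H.1.verts).ncard := by
    rw [Set.ncard_iUnion_of_finite (fun _ => Set.toFinite _), finsum_eq_sum_of_fintype]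
    intro H H' hne
    exact Set.disjoint_left.2 fun x hx hx' =>
      hne (Subtype.ext (hG.eq_of_mem H.2 H'.2 hx.2 hx'.2))
  conv_lhs => rw [h1]
  rw [Set.ncard_union_eq h2, h3]

/-- Each component `T` of `Γ_G` loses at least `|T| / k` vertices by `InR.le_ncard_compl`; the
components are disjoint, so the losses add up. -/
lemma ncard_nonCycleVerts_le [Finite V] {k : ℕ}
    (hT : ∀ T : (Gam G).ConnectedComponent,
      k ∣ Nat.card T ∧ InR k (Nat.card T / k) T.toSimpleGraph)
    {S : Set V} (hS : IsGenIndepSet G k S) :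
    (nonCycleVerts G).ncard ≤ k * (Sᶜ ∩ nonCycleVerts G).ncard := by
  classical
  have := Fintype.ofFinite (Gam G).ConnectedComponent
  have h1 : (nonCycleVerts G).ncard = ∑ T : (Gam G).ConnectedComponent, Nat.card T := by
    rw [← card_eq_sum_card_connectedComponent, Nat.card_coe_set_eq]
  have h2 : ∑ T : (Gam G).ConnectedComponent,
      (Sᶜ ∩ Subtype.val '' T.supp).ncard ≤ (Sᶜ ∩ nonCycleVerts G).ncard := by
    rw [← finsum_eq_sum_of_fintype, ← Set.ncard_iUnion_of_finite (fun _ => Set.toFinite _)]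
    · refine Set.ncard_le_ncard (Set.iUnion_subset fun T => Set.inter_subset_inter_right _ ?_)
      rintro _ ⟨x, -, rfl⟩
      exact x.2
    · intro T T' hne
      refine Set.disjoint_left.2 ?_
      rintro _ ⟨-, x, hx, rfl⟩ ⟨-, y, hy, hxy⟩
      obtain rfl := Subtype.ext hxy
      exact hne (ConnectedComponent.eq_of_common_vertex hx hy)
  rw [h1]
  refine le_trans ?_ (Nat.mul_le_mul_left k h2)
  rw [Finset.mul_sum]
  refine Finset.sum_le_sum fun T _ => ?_
  obtain ⟨hd, hR⟩ := hT T
  let f : T.toSimpleGraph →g G :=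
    { toFun := fun x => x.1.1
      map_rel' := fun {a b} h => h }
  have hf : Function.Injective f := Subtype.val_injective.comp Subtype.val_injective
  have h := hR.le_ncard_compl (hS.preimage f hf)
  rw [← Set.ncard_image_of_injective _ hf] at h
  have hsub : f '' (f ⁻¹' S)ᶜ ⊆ Sᶜ ∩ Subtype.val '' T.supp := by
    rintro _ ⟨x, hx, rfl⟩
    exact ⟨hx, x.1, x.2, rfl⟩
  calc Nat.card T = k * (Nat.card T / k) := (Nat.mul_div_cancel' hd).symm
    _ ≤ _ := Nat.mul_le_mul_left k (h.trans (Set.ncard_le_ncard hsub))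

theorem genIndepNum_le [Finite V] {k : ℕ} (hk : 2 ≤ k) (hG : CyclesDisjoint G)
    (hmod : ∀ (v : V) (c : G.Walk v v), c.IsCycle → c.length ≡ 1 [MOD k])
    (hT : ∀ T : (Gam G).ConnectedComponent,
      k ∣ Nat.card T ∧ InR k (Nat.card T / k) T.toSimpleGraph) :
    (k : ℤ) * genIndepNum G k ≤ ((k : ℤ) - 1) * ((Nat.card V : ℤ) - cycleDim G) := by
  have := Fintype.ofFinite (cycleSubgraphs G)
  obtain ⟨S, hS, hSα⟩ := exists_isGenIndepSet_ncard (G := G) (k := k) (by omega)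
  have h1 := hG.ncard_eq Set.univ
  simp only [Set.univ_inter, Set.ncard_univ] at h1
  have h2 := hG.ncard_eq Sᶜ
  have h3 := Set.ncard_add_ncard_compl S
  have h4 := ncard_nonCycleVerts_le hT hS
  have h5 : ∑ H : cycleSubgraphs G, (H.1.verts.ncard + k) ≤
      ∑ H : cycleSubgraphs G, (k * (Sᶜ ∩ H.1.verts).ncard + 1) := by
    refine Finset.sum_le_sum ?_
    rintro ⟨_, v, c, hc, rfl⟩ -
    exact ncard_verts_add_le_of_isGenIndepSet hk c hc (hmod v c hc) hS
  rw [Finset.sum_add_distrib, Finset.sum_add_distrib, ← Finset.mul_sum] at h5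
  simp only [Finset.sum_const, Finset.card_univ, smul_eq_mul, mul_one,
    ← Nat.card_eq_fintype_card, Nat.card_coe_set_eq] at h5
  have h6 := cycleDim_le_ncard (G := G)
  rw [hSα] at h3
  -- Adding the losses on `Γ_G` and on the cycles bounds the complement of `S` from below. The
  -- number of cycles has coefficient `k - 1 ≥ 0`, so it may be replaced by the smaller `ω(G)`.
  have h7 : Nat.card V + (cycleSubgraphs G).ncard * k ≤
      k * Sᶜ.ncard + (cycleSubgraphs G).ncard := by
    rw [h1, h2]
    linarith
  have h8 := mul_le_mul_of_nonneg_left h6 (show (0 : ℤ) ≤ (k : ℤ) - 1 by omega)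
  zify at h3 h7
  have h9 : (Sᶜ.ncard : ℤ) = Nat.card V - genIndepNum G k := by linarith
  rw [h9] at h7
  linarith

end GenIndep

theorem theorem1p3 {V : Type*} [Fintype V] (G : SimpleGraph V) (k : ℕ) (hk : 2 ≤ k) :
    ((k : ℝ) - 1) / k * ((Fintype.card V : ℝ) - (GenIndep.cycleDim G : ℝ)) ≤
        (GenIndep.genIndepNum G k : ℝ) ∧
      ((GenIndep.genIndepNum G k : ℝ) =
          ((k : ℝ) - 1) / k * ((Fintype.card V : ℝ) - (GenIndep.cycleDim G : ℝ)) ↔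
        GenIndep.CyclesDisjoint G ∧
        (∀ (v : V) (c : G.Walk v v), c.IsCycle → c.length ≡ 1 [MOD k]) ∧
        (∀ T : (GenIndep.Gam G).ConnectedComponent,
          k ∣ Nat.card T ∧ GenIndep.InR k (Nat.card T / k) T.toSimpleGraph)) := by
  have hk0 : (0 : ℝ) < k := by
    have : 0 < k := by omega
    exact_mod_cast this
  have hle := GenIndep.le_genIndepNum G (k := k) (by omega)
  rw [Nat.card_eq_fintype_card] at hle
  have heq : (GenIndep.genIndepNum G k : ℝ) =
      ((k : ℝ) - 1) / k * ((Fintype.card V : ℝ) - (GenIndep.cycleDim G : ℝ)) ↔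
      (k : ℤ) * GenIndep.genIndepNum G k =
        ((k : ℤ) - 1) * ((Nat.card V : ℤ) - GenIndep.cycleDim G) := by
    rw [div_mul_eq_mul_div, eq_div_iff hk0.ne', Nat.card_eq_fintype_card, mul_comm]
    exact_mod_cast Iff.rfl
  refine ⟨?_, ?_⟩
  · rw [div_mul_eq_mul_div, div_le_iff₀ hk0, mul_comm (GenIndep.genIndepNum G k : ℝ)]
    exact_mod_cast hle
  rw [heq]
  constructor
  · intro h
    have hG := GenIndep.cyclesDisjoint_of_genIndepNum_eq hk h
    exact ⟨hG, fun v c hc => GenIndep.length_modEq_one_of_genIndepNum_eq (by omega) hG h c hc,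
      GenIndep.inR_of_genIndepNum_eq (by omega) hG h⟩
  · rintro ⟨hG, hmod, hT⟩
    exact le_antisymm (GenIndep.genIndepNum_le hk hG hmod hT)
      (GenIndep.le_genIndepNum G (by omega))
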